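/- There is an absolute constant $c>0$ with the following property. Let $G=(V,E)$ be a connected undirected (simple) graph with $n\ge 2$ vertices. A vertex $v$ is a local minimum of $f:V\to\mathbb{R}$ if $f(v)\le f(u)$ for every edge $(u,v)\in E$. The vertex congestion $g$ of $G$ is the smallest integer for which one can choose, for every ordered pair $(u,w)\in V\times V$, a path from $u$ to $w$ in $G$ (the path from $u$ to $u$ being $(u)$) such that the maximum over $v\in V$ of the total number of occurrences of $v$ on the chosen paths equals $g$. Let $S\subseteq\mathbb{R}$ be a set of admissible function values (for instance $S=\mathbb{R}$, or a finite set) with at least $n^2+2n+1$ elements, and let $\mathrm{enc}$ be any injective encoding of the elements of $S$ as bit strings (all of the same, possibly infinite, length). A $T$-query quantum algorithm has states $\sum_{v,a,z}\alpha_{v,a,z}|v,a,z\rangle$ with $\sum|\alpha_{v,a,z}|^2=1$, where $v\in V$, $a$ is a bit string (answer register) and $z$ is a workspace content; starting from a fixed initial state it applies $U_0,Q,U_1,Q,\dots,Q,U_T$, where $U_0,\dots,U_T$ are unitary operators that do not depend on the input $f:V\to S$ and $Q$ is the oracle gate $|v,a,z\rangle\mapsto|v,a\oplus \mathrm{enc}(f(v)),z\rangle$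 ($\oplus$ is bitwise exclusive or). It solves local search on $G$ if, for every $f:V\to S$, the final amplitudes satisfy $\sum_{v,a,z:\ v \text{ a local minimum of } f}|\alpha_{v,a,z}|^2\ge 2/3$. The bounded-error quantum query complexity $Q(G)$ of local search on $G$ is the least $T$ for which a $T$-query quantum algorithm solves local search on $G$. Then $$Q(G)\ \ge\ c\cdot\frac{n^{3/4}}{\sqrt{g}}\,.$$ -/

import Mathlib

open scoped ENNReal

noncomputable section

namespace LocalSearch

/-! ### Vertex congestion -/

/-- An all-pairs set of paths: for all `u v`, a path from `u` to `v`.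
(The only path from `u` to `u` is the one-vertex path.) -/
abbrev AllPairsPaths {V : Type} (G : SimpleGraph V) : Type := ∀ u v : V, G.Path u v

/-- The vertex congestion of an all-pairs set of paths: the maximum over the vertices `v` of the
total number of occurrences of `v` on the paths of the set. -/
def AllPairsPaths.vertexCongestion {V : Type} [Fintype V] [DecidableEq V] {G : SimpleGraph V}
    (P : AllPairsPaths G) : ℕ :=
  Finset.univ.sup fun v : V => ∑ u : V, ∑ w : V, (P u w).1.support.count v

/-- The vertex congestion of a graph: the smallest integer `g` such that some all-pairs set of
paths has vertex congestion `g`. -/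
def vertexCongestion {V : Type} [Fintype V] [DecidableEq V] (G : SimpleGraph V) : ℕ :=
  sInf {g : ℕ | ∃ P : AllPairsPaths G, P.vertexCongestion = g}

/-! ### Local minima -/

/-- `v` is a local minimum of `f` on `G`: no neighbour of `v` has a smaller value. -/
def IsLocalMinimum {V : Type} (G : SimpleGraph V) (f : V → ℝ) (v : V) : Prop :=
  ∀ u, G.Adj v u → f v ≤ f u

/-! ### The quantum query model -/

/-- The labels of basis states `|v, a, z⟩`: a vertex `v`, a bit string `a` (the answer register,
with bit positions indexed by `B`) and the contents `z` of the workspace. -/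
abbrev Label (V B Z : Type) : Type := V × (B → Bool) × Z

/-- The Hilbert space with orthonormal basis `|v, a, z⟩`: families of complex amplitudes
`α (v, a, z)` with `∑ |α (v, a, z)|² < ∞`. -/
abbrev State (V B Z : Type) : Type := lp (fun _ : Label V B Z => ℂ) 2

/-- The permutation `(v, a, z) ↦ (v, a ⊕ x v, z)` of the labels, where `x v` is the bit string that
the oracle holds at `v` and `⊕` is bitwise exclusive or. -/
def oraclePerm {V B Z : Type} (x : V → B → Bool) : Equiv.Perm (Label V B Z) :=
  Function.Involutive.toPerm
    (fun l => (l.1, (fun i => Bool.xor (l.2.1 i) (x l.1 i)), l.2.2)) (fun l => by simp)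

theorem memℓp_comp_perm {ι : Type} (σ : Equiv.Perm ι) (ψ : lp (fun _ : ι => ℂ) 2) :
    Memℓp (fun l => (ψ : ι → ℂ) (σ l)) 2 := by
  have h := (memℓp_gen_iff (p := 2) (by norm_num)).1 (lp.memℓp ψ)
  exact (memℓp_gen_iff (p := 2) (by norm_num)).2 (σ.summable_iff.2 h)

/-- The oracle gate: the state `∑ α (v, a, z) |v, a, z⟩` becomes
`∑ α (v, a, z) |v, a ⊕ x v, z⟩`. -/
def query {V B Z : Type} (x : V → B → Bool) (ψ : State V B Z) : State V B Z :=
  ⟨fun l => (ψ : Label V B Z → ℂ) ((oraclePerm x).symm l), memℓp_comp_perm (oraclePerm x).symm ψ⟩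

/-- A quantum query algorithm making `T` queries: a workspace, a unit initial state, and unitary
operations `U 0, …, U T`, none of which depends on the input function. -/
structure QueryAlgorithm (V B : Type) (T : ℕ) where
  Z : Type
  init : State V B Z
  norm_init : ‖init‖ = 1
  U : Fin (T + 1) → (State V B Z ≃ₗᵢ[ℂ] State V B Z)

/-- The state after `U 0, Q, U 1, Q, …, Q, U t`, where `Q` is the oracle gate of `x`. -/
def QueryAlgorithm.stateAfter {V B : Type} {T : ℕ} (A : QueryAlgorithm V B T) (x : V → B → Bool) :
    (t : ℕ) → t < T + 1 → State V B A.Z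
  | 0, h => A.U ⟨0, h⟩ A.init
  | t + 1, h => A.U ⟨t + 1, h⟩ (query x (A.stateAfter x t (Nat.lt_of_succ_lt h)))

/-- The final state, after all `T` queries. -/
def QueryAlgorithm.finalState {V B : Type} {T : ℕ} (A : QueryAlgorithm V B T)
    (x : V → B → Bool) : State V B A.Z :=
  A.stateAfter x T (Nat.lt_succ_self T)

/-- The probability that measuring the vertex register of `ψ` gives a vertex in `W`. -/
def measureProb {V B Z : Type} (ψ : State V B Z) (W : Set V) : ℝ :=
  ∑' l : {l : Label V B Z // l.1 ∈ W}, ‖(ψ : Label V B Z → ℂ) l.1‖ ^ 2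

/-- `A` solves local search on `G` with bounded error, for functions with values in `S ⊆ ℝ`, where
the value `s ∈ S` is written into the answer register as the bit string `enc s`: for every
`f : V → S` the output is a local minimum of `f` with probability at least `2/3`. -/
def QueryAlgorithm.SolvesLocalSearch {V B : Type} {T : ℕ} (A : QueryAlgorithm V B T)
    (G : SimpleGraph V) {S : Set ℝ} (enc : S ↪ (B → Bool)) : Prop :=
  ∀ f : V → S,
    2 / 3 ≤ measureProb (A.finalState fun v => enc (f v))
      {v | IsLocalMinimum G (fun u => (f u : ℝ)) v}

/-- The bounded-error quantum query complexity of local search on `G`: the least number of queries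
of a quantum algorithm that succeeds on every input function. -/
def quantumQueryComplexity {V B : Type} (G : SimpleGraph V) {S : Set ℝ}
    (enc : S ↪ (B → Bool)) : ℕ∞ :=
  ⨅ (T : ℕ) (_ : ∃ A : QueryAlgorithm V B T, A.SolvesLocalSearch G enc), (T : ℕ∞)

end LocalSearch

end

namespace LocalSearch

/-! ### States, the oracle gate and the hybrid argument. -/

section Quantum

variable {V B Z : Type}

/-! Choose independent uniform milestones `y 0, …, y T` and join consecutive ones by paths of an
all-pairs system of least congestion `g`. `height` increases towards the end of this walk, so a
function decreasing in the height has `y T` as its only possible local minimum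
(`exists_adj_height_lt`).

The algorithm is compared with a hybrid run whose query number `t` (from 0) is answered using the
walk only up to `y t`. The hybrid state before that query depends only on `y 0, …, y (t - 1)`. The
true oracle differs from the hybrid one only on the later segments, whose endpoints are independent
of that state. A path between two random vertices meets a fixed vertex with probability at most `g /
n ^ 2`, so the expected query mass on the disagreement is at most `T * g / n ^ 2`
(`sum_measureProb_heightOracle_ne_le`). Each query thus costs at most `2 * √(T * g) / n` in norm on
average, while the final hybrid state is independent of `y T` and finds it with probability `1 / n ≤
1 / 2`.

Success therefore forces `n ^ 2 ≤ 576 * T ^ 3 * g` (`card_sq_le_of_solves`), which implies the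
stated bound because `g ≥ n`. -/

theorem summable_norm_sq (ψ : State V B Z) : Summable fun l => ‖(ψ : Label V B Z → ℂ) l‖ ^ 2 := by
  simpa using (memℓp_gen_iff (p := 2) (by norm_num)).1 (lp.memℓp ψ)

theorem norm_sq_eq_tsum (ψ : State V B Z) :
    ‖ψ‖ ^ 2 = ∑' l, ‖(ψ : Label V B Z → ℂ) l‖ ^ 2 := by
  simpa using lp.norm_rpow_eq_tsum (p := 2) (by norm_num) ψ

theorem norm_query (x : V → B → Bool) (ψ : State V B Z) : ‖query x ψ‖ = ‖ψ‖ := by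
  have h : ‖query x ψ‖ ^ 2 = ‖ψ‖ ^ 2 := by
    rw [norm_sq_eq_tsum, norm_sq_eq_tsum]
    exact (oraclePerm x).symm.tsum_eq fun l => ‖(ψ : Label V B Z → ℂ) l‖ ^ 2
  exact (sq_eq_sq₀ (norm_nonneg _) (norm_nonneg _)).1 h

theorem query_sub (x : V → B → Bool) (ψ φ : State V B Z) :
    query x (ψ - φ) = query x ψ - query x φ := rfl

open Classical in
/-- The part of a state whose vertex register lies in `W`. -/
noncomputable def restrict (W : Set V) (ψ : State V B Z) : State V B Z :=
  ⟨fun l => if l.1 ∈ W then (ψ : Label V B Z → ℂ) l else 0, by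
    refine (memℓp_gen_iff (p := 2) (by norm_num)).2 ?_
    refine Summable.of_nonneg_of_le (fun l => by positivity) (fun l => ?_)
      (by simpa using summable_norm_sq ψ)
    split_ifs <;> simp⟩

open Classical in
theorem restrict_apply (W : Set V) (ψ : State V B Z) (l : Label V B Z) :
    (restrict W ψ : Label V B Z → ℂ) l = if l.1 ∈ W then (ψ : Label V B Z → ℂ) l else 0 := rfl

theorem restrict_sub (W : Set V) (ψ φ : State V B Z) :
    restrict W (ψ - φ) = restrict W ψ - restrict W φ := by
  ext l
  rw [restrict_apply, lp.coeFn_sub, lp.coeFn_sub, Pi.sub_apply, Pi.sub_apply, restrict_apply,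
    restrict_apply]
  split_ifs <;> simp

open Classical in
theorem measureProb_eq_tsum (ψ : State V B Z) (W : Set V) :
    measureProb ψ W = ∑' l, if l.1 ∈ W then ‖(ψ : Label V B Z → ℂ) l‖ ^ 2 else 0 := by
  unfold measureProb
  refine (tsum_subtype {l : Label V B Z | l.1 ∈ W}
    fun l => ‖(ψ : Label V B Z → ℂ) l‖ ^ 2).trans ?_
  simp only [Set.indicator_apply, Set.mem_ofPred_eq]

theorem norm_restrict_sq (W : Set V) (ψ : State V B Z) :
    ‖restrict W ψ‖ ^ 2 = measureProb ψ W := by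
  classical
  rw [norm_sq_eq_tsum, measureProb_eq_tsum]
  refine tsum_congr fun l => ?_
  rw [restrict_apply]
  split_ifs <;> simp

theorem measureProb_nonneg (ψ : State V B Z) (W : Set V) : 0 ≤ measureProb ψ W := by
  rw [← norm_restrict_sq]; positivity

open Classical in
theorem summable_measureProb (ψ : State V B Z) (W : Set V) :
    Summable fun l : Label V B Z => if l.1 ∈ W then ‖(ψ : Label V B Z → ℂ) l‖ ^ 2 else 0 := by
  refine Summable.of_nonneg_of_le (fun l => ?_) (fun l => ?_) (summable_norm_sq ψ)
  all_goals split_ifs <;> first | positivity | exact le_rfl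

theorem measureProb_mono (ψ : State V B Z) {W W' : Set V} (h : W ⊆ W') :
    measureProb ψ W ≤ measureProb ψ W' := by
  classical
  rw [measureProb_eq_tsum, measureProb_eq_tsum]
  refine (summable_measureProb ψ W).tsum_le_tsum (fun l => ?_) (summable_measureProb ψ W')
  by_cases hl : l.1 ∈ W
  · simp [hl, h hl]
  · simp only [hl, if_false]; split_ifs <;> positivity

theorem measureProb_univ (ψ : State V B Z) : measureProb ψ Set.univ = ‖ψ‖ ^ 2 := by
  classical
  rw [measureProb_eq_tsum, norm_sq_eq_tsum]
  simp

theorem norm_restrict_le (W : Set V) (ψ : State V B Z) : ‖restrict W ψ‖ ≤ ‖ψ‖ := by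
  refine (sq_le_sq₀ (norm_nonneg _) (norm_nonneg _)).1 ?_
  rw [norm_restrict_sq, ← measureProb_univ]
  exact measureProb_mono ψ (Set.subset_univ W)

open Classical in
theorem measureProb_eq_sum [Fintype V] (ψ : State V B Z) (W : Set V) :
    measureProb ψ W = ∑ v, if v ∈ W then measureProb ψ {v} else 0 := by
  have h : ∀ v, (if v ∈ W then measureProb ψ {v} else 0) =
      ∑' l : Label V B Z, if l.1 ∈ (W ∩ {v} : Set V) then ‖(ψ : Label V B Z → ℂ) l‖ ^ 2 else 0 := by
    intro v
    by_cases hv : v ∈ W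
    · rw [if_pos hv, measureProb_eq_tsum]
      refine tsum_congr fun l => ?_
      have : l.1 ∈ ({v} : Set V) ↔ l.1 ∈ (W ∩ {v} : Set V) :=
        ⟨fun h => ⟨by rw [Set.mem_singleton_iff.1 h]; exact hv, h⟩, fun h => h.2⟩
      simp only [this]
    · have : ∀ l : Label V B Z, l.1 ∉ (W ∩ {v} : Set V) := fun l h =>
        hv (Set.mem_singleton_iff.1 h.2 ▸ h.1)
      simp only [hv, this, if_false, tsum_zero]
  rw [Finset.sum_congr rfl fun v _ => h v, measureProb_eq_tsum]
  refine Eq.trans ?_ (Summable.tsum_finsetSum fun v _ => by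
    convert summable_measureProb ψ (W ∩ {v}))
  refine tsum_congr fun l => ?_
  rw [Finset.sum_eq_single l.1]
  · simp
  · intro v _ hv
    simp [hv.symm]
  · simp

theorem sum_measureProb_singleton [Fintype V] (ψ : State V B Z) :
    ∑ v, measureProb ψ {v} = ‖ψ‖ ^ 2 := by
  classical
  rw [← measureProb_univ, measureProb_eq_sum]
  simp

/-- The two gates agree on basis states whose vertex lies outside the disagreement set, so only the
part of the state inside it contributes, once per gate. -/
theorem norm_query_sub_query_le (x y : V → B → Bool) (ψ : State V B Z) :
    ‖query x ψ - query y ψ‖ ≤ 2 * √(measureProb ψ {v | x v ≠ y v}) := by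
  set D : Set V := {v | x v ≠ y v}
  have h : query x ψ - query y ψ = query x (restrict D ψ) - query y (restrict D ψ) := by
    ext l
    rw [lp.coeFn_sub, lp.coeFn_sub, Pi.sub_apply, Pi.sub_apply]
    change (ψ : Label V B Z → ℂ) ((oraclePerm x).symm l) - (ψ : Label V B Z → ℂ)
      ((oraclePerm y).symm l) = (restrict D ψ : Label V B Z → ℂ) ((oraclePerm x).symm l) -
        (restrict D ψ : Label V B Z → ℂ) ((oraclePerm y).symm l)
    have hx : ((oraclePerm x).symm l).1 = l.1 := rfl
    have hy : ((oraclePerm y).symm l).1 = l.1 := rfl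
    rw [restrict_apply, restrict_apply, hx, hy]
    by_cases hl : l.1 ∈ D
    · simp [hl]
    · have hxy : x l.1 = y l.1 := not_not.1 hl
      have : (oraclePerm x).symm l = (oraclePerm y).symm l := by
        change (l.1, (fun i => Bool.xor (l.2.1 i) (x l.1 i)), l.2.2) =
          (l.1, (fun i => Bool.xor (l.2.1 i) (y l.1 i)), l.2.2)
        rw [hxy]
      simp [this, hl]
  have hD : √(measureProb ψ D) = ‖restrict D ψ‖ := by
    rw [← norm_restrict_sq, Real.sqrt_sq (norm_nonneg _)]
  rw [h, hD]
  refine (norm_sub_le _ _).trans ?_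
  rw [norm_query, norm_query, two_mul]

/-- Factor `a ^ 2 - b ^ 2 = (a + b) * (a - b)` for the norms of the restrictions, both at most 1. -/
theorem measureProb_le_add (ψ φ : State V B Z) (hψ : ‖ψ‖ = 1) (hφ : ‖φ‖ = 1) (W : Set V) :
    measureProb ψ W ≤ measureProb φ W + 2 * ‖ψ - φ‖ := by
  rw [← norm_restrict_sq, ← norm_restrict_sq]
  have h1 : ‖restrict W ψ‖ - ‖restrict W φ‖ ≤ ‖ψ - φ‖ :=
    (norm_sub_norm_le _ _).trans (by rw [← restrict_sub]; exact norm_restrict_le W _)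
  have h2 := norm_restrict_le W ψ
  have h3 := norm_restrict_le W φ
  nlinarith [norm_nonneg (restrict W ψ), norm_nonneg (restrict W φ), norm_nonneg (ψ - φ)]

variable {T : ℕ}

/-- The state after `t` queries when the `s`-th query is answered by its own oracle `O s`. -/
noncomputable def QueryAlgorithm.hybridState (A : QueryAlgorithm V B T) (O : ℕ → V → B → Bool) :
    ℕ → State V B A.Z
  | 0 => A.U 0 A.init
  -- `Fin.ofNat` reduces modulo `T + 1`; only times up to `T`, where nothing wraps, are compared
  -- with the real run.
  | t + 1 => A.U (Fin.ofNat (T + 1) (t + 1)) (query (O t) (A.hybridState O t))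

theorem QueryAlgorithm.norm_hybridState (A : QueryAlgorithm V B T) (O : ℕ → V → B → Bool) (t : ℕ) :
    ‖A.hybridState O t‖ = 1 := by
  induction t with
  | zero => simp [hybridState, A.norm_init]
  | succ t ih => rw [hybridState, LinearIsometryEquiv.norm_map, norm_query, ih]

theorem QueryAlgorithm.norm_stateAfter (A : QueryAlgorithm V B T) (x : V → B → Bool) (t : ℕ)
    (ht : t < T + 1) : ‖A.stateAfter x t ht‖ = 1 := by
  induction t with
  | zero => simp [stateAfter, A.norm_init]
  | succ t ih => rw [stateAfter, LinearIsometryEquiv.norm_map, norm_query, ih]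

theorem QueryAlgorithm.hybridState_congr (A : QueryAlgorithm V B T) {O O' : ℕ → V → B → Bool}
    (t : ℕ) (h : ∀ s < t, O s = O' s) : A.hybridState O t = A.hybridState O' t := by
  induction t with
  | zero => rfl
  | succ t ih => rw [hybridState, hybridState, h t t.lt_succ_self, ih fun s hs => h s (by omega)]

/-- Unitaries and the gate preserve distances, so errors only add up. Each new error is measured on
the hybrid state, not the true one, which later permits averaging over unseen milestones. -/
theorem QueryAlgorithm.norm_stateAfter_sub_hybridState_le (A : QueryAlgorithm V B T)
    (x : V → B → Bool) (O : ℕ → V → B → Bool) (t : ℕ) (ht : t < T + 1) :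
    ‖A.stateAfter x t ht - A.hybridState O t‖ ≤
      ∑ s ∈ Finset.range t, 2 * √(measureProb (A.hybridState O s) {v | x v ≠ O s v}) := by
  induction t with
  | zero => simp [stateAfter, hybridState]
  | succ t ih =>
    have hU : Fin.ofNat (T + 1) (t + 1) = ⟨t + 1, ht⟩ := Fin.ext (Nat.mod_eq_of_lt ht)
    rw [stateAfter, hybridState, hU, ← map_sub, LinearIsometryEquiv.norm_map,
      Finset.sum_range_succ]
    refine (norm_sub_le_norm_sub_add_norm_sub _ (query x (A.hybridState O t)) _).trans ?_
    refine add_le_add ?_ (norm_query_sub_query_le x (O t) _)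
    rw [← query_sub, norm_query]
    exact ih _

end Quantum

/-! ### The height function along a walk, and congestion. -/

section Graph

theorem dist_lt_card {V : Type} [Fintype V] {G : SimpleGraph V}
    (hG : G.Connected) (u v : V) : G.dist u v < Fintype.card V := by
  obtain ⟨p, hp⟩ := hG.exists_isPath u v
  exact (SimpleGraph.dist_le p).trans_lt hp.length_lt

theorem exists_adj_dist_lt {V : Type} {G : SimpleGraph V} (hG : G.Connected)
    {u v : V} (h : u ≠ v) :
    ∃ w, G.Adj u w ∧ G.dist w v < G.dist u v := by
  obtain ⟨p, hp⟩ := (hG.preconnected u v).exists_walk_length_eq_dist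
  cases p with
  | nil => exact absurd rfl h
  | cons hadj q =>
    refine ⟨_, hadj, ?_⟩
    rw [← hp, SimpleGraph.Walk.length_cons]
    exact Nat.lt_succ_of_le (SimpleGraph.dist_le q)

theorem exists_adj_idxOf_eq {V : Type} [DecidableEq V] {G : SimpleGraph V} {a b v : V}
    (p : G.Path a b) (h : v ∈ p.1.support) (hv : v ≠ b) :
    ∃ u ∈ p.1.support, G.Adj v u ∧ p.1.support.idxOf u = p.1.support.idxOf v + 1 := by
  have hk := List.idxOf_lt_length_of_mem h
  set k := p.1.support.idxOf v
  have hvk : p.1.getVert k = v := by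
    rw [← SimpleGraph.Walk.support_getElem_eq_getVert p.1 hk]
    exact List.getElem_idxOf hk
  have hk' := hk
  rw [SimpleGraph.Walk.length_support] at hk'
  have hlt : k < p.1.length := by
    refine lt_of_le_of_ne (by omega) fun he => hv ?_
    rw [← hvk, he, SimpleGraph.Walk.getVert_length]
  refine ⟨p.1.getVert (k + 1), p.1.getVert_mem_support _, ?_, ?_⟩
  · have := p.1.adj_getVert_succ hlt
    rwa [hvk] at this
  · have hk1 : k + 1 < p.1.support.length := by
      rw [SimpleGraph.Walk.length_support]; omega
    rw [← SimpleGraph.Walk.support_getElem_eq_getVert p.1 hk1]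
    exact p.2.support_nodup.idxOf_getElem _ hk1

variable {V : Type} [Fintype V] [DecidableEq V] {G : SimpleGraph V}

/-- The height of a vertex relative to the walk through the milestones `y 0, …, y m`: vertices on
the walk are ordered by their last visit, and the others lie below, ordered by their distance to
the start. -/
noncomputable def height (P : AllPairsPaths G) (y : ℕ → V) : ℕ → V → ℕ
  | 0, v => Fintype.card V - G.dist v (y 0)
  | m + 1, v =>
    if v ∈ (P (y m) (y (m + 1))).1.support then
      (m + 1) * Fintype.card V + (P (y m) (y (m + 1))).1.support.idxOf v + 1
    else height P y m v

theorem idxOf_support_lt {a b v : V} (p : G.Path a b) (h : v ∈ p.1.support) :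
    p.1.support.idxOf v < Fintype.card V := by
  have h1 := List.idxOf_lt_length_of_mem h
  have h2 := p.2.length_lt
  rw [SimpleGraph.Walk.length_support] at h1
  omega

/-- Heights come in blocks of length `n`, one per segment, so each new segment lies strictly above
everything earlier. -/
theorem height_le (P : AllPairsPaths G) (y : ℕ → V) (m : ℕ) (v : V) :
    height P y m v ≤ (m + 1) * Fintype.card V := by
  induction m with
  | zero => simp [height]
  | succ m ih =>
    rw [height]
    split_ifs with h
    · have := idxOf_support_lt _ h
      nlinarith
    · nlinarith

theorem height_le_height_succ (P : AllPairsPaths G) (y : ℕ → V) (m : ℕ) (v : V) :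
    height P y m v ≤ height P y (m + 1) v := by
  have := height_le P y m v
  rw [height]
  split_ifs <;> omega

theorem height_congr (P : AllPairsPaths G) {y y' : ℕ → V} (m : ℕ) (h : ∀ i ≤ m, y i = y' i) :
    height P y m = height P y' m := by
  induction m with
  | zero => funext v; simp [height, h 0]
  | succ m ih =>
    funext v
    rw [height, height, h m (by omega), h (m + 1) le_rfl, ih fun i hi => h i (by omega)]

theorem exists_mem_support_of_height_ne (P : AllPairsPaths G) (y : ℕ → V) {t m : ℕ} (htm : t ≤ m)
    {v : V} (h : height P y m v ≠ height P y t v) :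
    ∃ i ∈ Finset.Ico t m, v ∈ (P (y i) (y (i + 1))).1.support := by
  induction m, htm using Nat.le_induction with
  | base => exact absurd rfl h
  | succ m htm ih =>
    by_cases hv : v ∈ (P (y m) (y (m + 1))).1.support
    · exact ⟨m, by simp [htm], hv⟩
    · rw [height, if_neg hv] at h
      obtain ⟨i, hi, hvi⟩ := ih h
      exact ⟨i, by simp only [Finset.mem_Ico] at hi ⊢; omega, hvi⟩

theorem exists_adj_height_lt (hG : G.Connected) (P : AllPairsPaths G) (y : ℕ → V) (m : ℕ) {v : V}
    (hv : v ≠ y m) : ∃ u, G.Adj v u ∧ height P y m v < height P y m u := by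
  induction m with
  | zero =>
    obtain ⟨u, hu, hlt⟩ := exists_adj_dist_lt hG hv
    have := dist_lt_card hG v (y 0)
    exact ⟨u, hu, by simp only [height]; omega⟩
  | succ m ih =>
    by_cases h : v ∈ (P (y m) (y (m + 1))).1.support
    · obtain ⟨u, hu, hadj, hidx⟩ := exists_adj_idxOf_eq _ h hv
      exact ⟨u, hadj, by rw [height, height, if_pos h, if_pos hu, hidx]; omega⟩
    -- The old endpoint starts the new segment, so off that segment the induction hypothesis
    -- applies; the higher neighbour can only be raised further.
    · have hne : v ≠ y m := fun he => h (he ▸ SimpleGraph.Walk.start_mem_support _)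
      obtain ⟨u, hadj, hlt⟩ := ih hne
      refine ⟨u, hadj, lt_of_lt_of_le ?_ (height_le_height_succ P y m u)⟩
      rwa [height, if_neg h]

theorem exists_vertexCongestion_eq (hG : G.Connected) :
    ∃ P : AllPairsPaths G, P.vertexCongestion = vertexCongestion G := by
  refine Nat.sInf_mem (s := {g : ℕ | ∃ P : AllPairsPaths G, P.vertexCongestion = g}) ?_
  choose p hp using hG.exists_isPath
  exact ⟨_, fun u v => ⟨p u v, hp u v⟩, rfl⟩

theorem sum_count_le_vertexCongestion (P : AllPairsPaths G) (v : V) :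
    ∑ u : V, ∑ w : V, (P u w).1.support.count v ≤ P.vertexCongestion :=
  Finset.le_sup (f := fun v : V => ∑ u : V, ∑ w : V, (P u w).1.support.count v)
    (Finset.mem_univ v)

/-- Already the `n` paths starting at a vertex all contain it. -/
theorem card_le_vertexCongestion [Nonempty V] (P : AllPairsPaths G) :
    Fintype.card V ≤ P.vertexCongestion := by
  obtain ⟨v⟩ := ‹Nonempty V›
  refine le_trans ?_ (sum_count_le_vertexCongestion P v)
  refine le_trans ?_ (Finset.single_le_sum (f := fun u => ∑ w : V, (P u w).1.support.count v)
    (fun _ _ => Nat.zero_le _) (Finset.mem_univ v))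
  rw [← Finset.card_univ, Finset.card_eq_sum_ones]
  refine Finset.sum_le_sum fun w _ => ?_
  exact List.count_pos_iff.2 (SimpleGraph.Walk.start_mem_support _)

theorem exists_strictAnti_values {S : Set ℝ} {N : ℕ} (h : ((N + 1 : ℕ) : ℕ∞) ≤ S.encard) :
    ∃ e : ℕ → S, ∀ i j, i < j → j ≤ N → (e j : ℝ) < e i := by
  obtain ⟨t, htS, ht⟩ := Set.exists_subset_encard_eq h
  have hfin : t.Finite := Set.finite_of_encard_eq_coe ht
  have hcard : hfin.toFinset.card = N + 1 := by
    have := hfin.encard_eq_coe_toFinset_card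
    rw [ht] at this
    exact_mod_cast this.symm
  let o := hfin.toFinset.orderEmbOfFin hcard
  refine ⟨fun k => ⟨o (Fin.ofNat (N + 1) (N - k)), htS ?_⟩, fun i j hij hj => ?_⟩
  · exact hfin.mem_toFinset.1 (Finset.orderEmbOfFin_mem _ hcard _)
  · refine o.strictMono ?_
    rw [Fin.lt_def]
    simp only [Fin.val_ofNat]
    rw [Nat.mod_eq_of_lt (by omega), Nat.mod_eq_of_lt (by omega)]
    omega

end Graph

/-! ### Averaging over random milestones by resampling coordinates. -/

section Averaging

variable {ι V : Type} [Fintype ι] [DecidableEq ι] [Fintype V]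

/-- Exchanging the coordinate `x i` with the fresh value `a` is an involution on pairs `(x, a)`. -/
theorem sum_sum_update (F : (ι → V) → ℝ) (i : ι) :
    ∑ x, ∑ a, F (Function.update x i a) = Fintype.card V * ∑ x, F x := by
  let σ : Equiv.Perm ((ι → V) × V) := Function.Involutive.toPerm
    (fun p => (Function.update p.1 i p.2, p.1 i)) (fun p => by simp)
  calc ∑ x, ∑ a, F (Function.update x i a) = ∑ p : (ι → V) × V, F (σ p).1 :=
        (Fintype.sum_prod_type' fun x a => F (Function.update x i a)).symm
    _ = ∑ p : (ι → V) × V, F p.1 := Equiv.sum_comp σ fun p => F p.1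
    _ = Fintype.card V * ∑ x, F x := by
        rw [Fintype.sum_prod_type, Finset.mul_sum]
        simp

theorem card_mul_sum_apply_eq (i : ι) (M : (ι → V) → V → ℝ) (hM : ∀ x, ∑ v, M x v = 1)
    (hi : ∀ x a, M (Function.update x i a) = M x) :
    Fintype.card V * ∑ x, M x (x i) = Fintype.card (ι → V) := by
  rw [← sum_sum_update (fun x => M x (x i)) i]
  simp [hi, hM]

/-- Resampling both endpoints leaves the distribution `M x` fixed while the path runs over all
pairs; each vertex is then met at most congestion many times, and the weights sum to 1. -/
theorem card_sq_mul_sum_path_le [DecidableEq V] {G : SimpleGraph V}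
    (P : AllPairsPaths G) {j k : ι} (hjk : j ≠ k)
    (M : (ι → V) → V → ℝ) (h0 : ∀ x v, 0 ≤ M x v) (hM : ∀ x, ∑ v, M x v = 1)
    (hj : ∀ x a, M (Function.update x j a) = M x) (hk : ∀ x a, M (Function.update x k a) = M x) :
    (Fintype.card V : ℝ) ^ 2 *
        ∑ x, ∑ v, (if v ∈ (P (x j) (x k)).1.support then M x v else 0) ≤
      Fintype.card (ι → V) * P.vertexCongestion := by
  set F : (ι → V) → ℝ := fun x => ∑ v, (if v ∈ (P (x j) (x k)).1.support then M x v else 0)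
  have h1 : (Fintype.card V : ℝ) ^ 2 * ∑ x, F x =
      ∑ x, ∑ a, ∑ b, F (Function.update (Function.update x j a) k b) := by
    rw [sum_sum_update (fun x => ∑ b, F (Function.update x k b)) j, sum_sum_update F k]
    ring
  have h2 : ∀ x a b, F (Function.update (Function.update x j a) k b) =
      ∑ v, (if v ∈ (P a b).1.support then M x v else 0) := by
    intro x a b
    have hxj : Function.update (Function.update x j a) k b j = a := by
      rw [Function.update_of_ne hjk, Function.update_self]
    have hxk : Function.update (Function.update x j a) k b k = b := Function.update_self _ _ _
    simp only [F]
    rw [hxj, hxk, hk, hj]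
  have h3 : ∀ x, ∑ a, ∑ b, F (Function.update (Function.update x j a) k b) ≤
      P.vertexCongestion := by
    intro x
    calc ∑ a, ∑ b, F (Function.update (Function.update x j a) k b)
        = ∑ v, ∑ a, ∑ b, (if v ∈ (P a b).1.support then M x v else 0) := by
          simp only [h2]
          rw [Finset.sum_congr rfl fun a _ => Finset.sum_comm, Finset.sum_comm]
      _ ≤ ∑ v, P.vertexCongestion * M x v := by
          refine Finset.sum_le_sum fun v _ => ?_
          refine le_trans ?_ (mul_le_mul_of_nonneg_right
            (Nat.cast_le.2 (sum_count_le_vertexCongestion P v)) (h0 x v))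
          push_cast
          rw [Finset.sum_mul]
          refine Finset.sum_le_sum fun a _ => ?_
          rw [Finset.sum_mul]
          refine Finset.sum_le_sum fun b _ => ?_
          split_ifs with h
          · have : (1 : ℝ) ≤ ((P a b).1.support.count v : ℝ) :=
              Nat.one_le_cast.2 (List.count_pos_iff.2 h)
            exact le_mul_of_one_le_left (h0 x v) this
          · exact mul_nonneg (Nat.cast_nonneg _) (h0 x v)
      _ = P.vertexCongestion := by rw [← Finset.mul_sum, hM, mul_one]
  rw [h1]
  refine (Finset.sum_le_sum fun x _ => h3 x).trans ?_
  simp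

end Averaging

/-! ### The lower bound on the number of queries. -/

section LowerBound

/-- The milestones of a walk, given by a tuple. -/
def milestones {V : Type} {T : ℕ} (x : Fin (T + 1) → V) (k : ℕ) : V := x (Fin.ofNat (T + 1) k)

theorem milestones_update_of_ne {V : Type} {T : ℕ} (x : Fin (T + 1) → V) {i k : ℕ} (hi : i ≤ T)
    (hk : k ≤ T)
    (h : k ≠ i) (a : V) :
    milestones (Function.update x (Fin.ofNat (T + 1) i) a) k = milestones x k := by
  refine Function.update_of_ne (fun he => h ?_) _ _
  have := congrArg Fin.val he
  simpa only [Fin.val_ofNat, Nat.mod_eq_of_lt (Nat.lt_succ_of_le hi),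
    Nat.mod_eq_of_lt (Nat.lt_succ_of_le hk)] using this

variable {V B : Type} [Fintype V] [DecidableEq V] {G : SimpleGraph V} {T : ℕ}

/-- The oracle answers for the function whose value decreases with the height. -/
noncomputable def heightOracle (P : AllPairsPaths G) {S : Set ℝ} (enc : S ↪ (B → Bool)) (e : ℕ → S)
    (x : Fin (T + 1) → V) (t : ℕ) (v : V) : B → Bool :=
  enc (e (height P (milestones x) t v))

/-- Before query `t` only the oracles of index below `t` have been used, and these involve only
milestones of index below `t`. -/
theorem hybridState_heightOracle_update (A : QueryAlgorithm V B T) (P : AllPairsPaths G)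
    {S : Set ℝ} (enc : S ↪ (B → Bool)) (e : ℕ → S) {t i : ℕ} (hti : t ≤ i) (hi : i ≤ T)
    (x : Fin (T + 1) → V) (a : V) :
    A.hybridState (heightOracle P enc e (Function.update x (Fin.ofNat (T + 1) i) a)) t =
      A.hybridState (heightOracle P enc e x) t := by
  refine A.hybridState_congr t fun s hs => funext fun v => ?_
  unfold heightOracle
  rw [height_congr P s fun k hk => milestones_update_of_ne x hi (by omega) (by omega) a]

theorem isLocalMinimum_height (hG : G.Connected) (P : AllPairsPaths G) {S : Set ℝ} {e : ℕ → S}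
    {N : ℕ} (he : ∀ i j, i < j → j ≤ N → (e j : ℝ) < e i) (y : ℕ → V) {m : ℕ}
    (hN : (m + 1) * Fintype.card V ≤ N) {v : V}
    (hv : IsLocalMinimum G (fun u => (e (height P y m u) : ℝ)) v) : v = y m := by
  by_contra hne
  obtain ⟨u, hadj, hlt⟩ := exists_adj_height_lt hG P y m hne
  exact (hv u hadj).not_gt (he _ _ hlt ((height_le P y m u).trans hN))

theorem measureProb_heightOracle_ne_le (P : AllPairsPaths G) {Z : Type} (ψ : State V B Z)
    {S : Set ℝ} (enc : S ↪ (B → Bool)) (e : ℕ → S) (x : Fin (T + 1) → V) {t : ℕ} (ht : t ≤ T) :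
    measureProb ψ {v | heightOracle P enc e x T v ≠ heightOracle P enc e x t v} ≤
      ∑ i ∈ Finset.Ico t T, ∑ v, (if v ∈ (P (milestones x i) (milestones x (i + 1))).1.support
        then measureProb ψ {v} else 0) := by
  classical
  rw [measureProb_eq_sum, Finset.sum_comm]
  refine Finset.sum_le_sum fun v _ => ?_
  have h0 : ∀ i ∈ Finset.Ico t T, 0 ≤ (if v ∈ (P (milestones x i)
      (milestones x (i + 1))).1.support then measureProb ψ {v} else 0) := fun i _ => by
    split_ifs
    exacts [measureProb_nonneg _ _, le_rfl]
  split_ifs with hv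
  · have hne : height P (milestones x) T v ≠ height P (milestones x) t v := fun he =>
      hv (by unfold heightOracle; rw [he])
    obtain ⟨i, hi, hvi⟩ := exists_mem_support_of_height_ne P _ ht hne
    refine le_trans ?_ (Finset.single_le_sum h0 hi)
    rw [if_pos hvi]
  · exact Finset.sum_nonneg h0

theorem sum_measureProb_heightOracle_ne_le (A : QueryAlgorithm V B T) (P : AllPairsPaths G)
    {S : Set ℝ} (enc : S ↪ (B → Bool)) (e : ℕ → S) {t : ℕ} (ht : t < T) :
    (Fintype.card V : ℝ) ^ 2 * ∑ x : Fin (T + 1) → V,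
        measureProb (A.hybridState (heightOracle P enc e x) t)
          {v | heightOracle P enc e x T v ≠ heightOracle P enc e x t v} ≤
      T * (Fintype.card (Fin (T + 1) → V) * P.vertexCongestion) := by
  refine (mul_le_mul_of_nonneg_left (Finset.sum_le_sum fun x _ =>
    measureProb_heightOracle_ne_le P _ enc e x ht.le) (by positivity)).trans ?_
  rw [Finset.sum_comm, Finset.mul_sum]
  refine (Finset.sum_le_card_nsmul _ _ (Fintype.card (Fin (T + 1) → V) * P.vertexCongestion : ℝ)
    fun i hi => ?_).trans ?_
  · obtain ⟨hti, hiT⟩ := Finset.mem_Ico.1 hi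
    refine card_sq_mul_sum_path_le P (j := Fin.ofNat (T + 1) i) (k := Fin.ofNat (T + 1) (i + 1)) ?_
      (fun x v => measureProb (A.hybridState (heightOracle P enc e x) t) {v})
      (fun x v => measureProb_nonneg _ _) (fun x => ?_) (fun x a => ?_) (fun x a => ?_)
    · intro he
      have := congrArg Fin.val he
      simp only [Fin.val_ofNat] at this
      rw [Nat.mod_eq_of_lt (by omega), Nat.mod_eq_of_lt (by omega)] at this
      omega
    · rw [sum_measureProb_singleton, A.norm_hybridState, one_pow]
    · rw [hybridState_heightOracle_update A P enc e hti hiT.le]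
    · rw [hybridState_heightOracle_update A P enc e (by omega) hiT]
  · rw [Nat.card_Ico, nsmul_eq_mul]
    refine mul_le_mul_of_nonneg_right ?_ (by positivity)
    exact_mod_cast Nat.sub_le T t

/-- Cauchy–Schwarz: the mean of the square roots is at most the root of the mean. -/
theorem sum_sqrt_le {ι : Type} [Fintype ι] (D : ι → ℝ) (h0 : ∀ x, 0 ≤ D x) {r : ℝ}
    (h : ∑ x, D x ≤ Fintype.card ι * r ^ 2) (hr : 0 ≤ r) : ∑ x, √(D x) ≤ Fintype.card ι * r := by
  refine (sq_le_sq₀ (Finset.sum_nonneg fun _ _ => Real.sqrt_nonneg _) (by positivity)).1 ?_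
  refine sq_sum_le_card_mul_sum_sq.trans ?_
  simp only [Real.sq_sqrt (h0 _), Finset.card_univ]
  calc (Fintype.card ι : ℝ) * ∑ x, D x ≤ Fintype.card ι * (Fintype.card ι * r ^ 2) :=
        mul_le_mul_of_nonneg_left h (by positivity)
    _ = (Fintype.card ι * r) ^ 2 := by ring

theorem success_le (hG : G.Connected) (P : AllPairsPaths G) (A : QueryAlgorithm V B T)
    {S : Set ℝ} (enc : S ↪ (B → Bool)) (hA : A.SolvesLocalSearch G enc) {e : ℕ → S} {N : ℕ}
    (he : ∀ i j, i < j → j ≤ N → (e j : ℝ) < e i) (hN : (T + 1) * Fintype.card V ≤ N)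
    (x : Fin (T + 1) → V) :
    2 / 3 ≤ measureProb (A.hybridState (heightOracle P enc e x) T) {x (Fin.ofNat (T + 1) T)} +
      4 * ∑ t ∈ Finset.range T, √(measureProb (A.hybridState (heightOracle P enc e x) t)
        {v | heightOracle P enc e x T v ≠ heightOracle P enc e x t v}) := by
  have h1 := hA fun v => e (height P (milestones x) T v)
  have h2 : measureProb (A.finalState (heightOracle P enc e x T))
      {v | IsLocalMinimum G (fun u => (e (height P (milestones x) T u) : ℝ)) v} ≤
      measureProb (A.finalState (heightOracle P enc e x T)) {milestones x T} :=
    measureProb_mono _ fun v hv => isLocalMinimum_height hG P he _ hN hv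
  have h3 := measureProb_le_add (A.finalState (heightOracle P enc e x T))
    (A.hybridState (heightOracle P enc e x) T) (A.norm_stateAfter _ _ _) (A.norm_hybridState _ _)
    {milestones x T}
  have h4 := A.norm_stateAfter_sub_hybridState_le (heightOracle P enc e x T)
    (heightOracle P enc e x) T T.lt_succ_self
  rw [← Finset.mul_sum] at h4
  have h5 := (h1.trans h2).trans h3
  unfold QueryAlgorithm.finalState at h5
  change 2 / 3 ≤ measureProb _ {milestones x T} + _
  linarith

theorem card_sq_le_of_solves (hG : G.Connected) (hV : 2 ≤ Fintype.card V) (P : AllPairsPaths G)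
    (A : QueryAlgorithm V B T) {S : Set ℝ} (enc : S ↪ (B → Bool))
    (hA : A.SolvesLocalSearch G enc) {N : ℕ} (hS : ((N + 1 : ℕ) : ℕ∞) ≤ S.encard)
    (hN : (T + 1) * Fintype.card V ≤ N) :
    (Fintype.card V : ℝ) ^ 2 ≤ 576 * (T ^ 3 * P.vertexCongestion) := by
  obtain ⟨e, he⟩ := exists_strictAnti_values hS
  have hn : (2 : ℝ) ≤ Fintype.card V := by exact_mod_cast hV
  have : Nonempty V := hG.nonempty
  set n : ℝ := (Fintype.card V : ℝ)
  set g : ℝ := (P.vertexCongestion : ℝ)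
  set K : ℝ := (Fintype.card (Fin (T + 1) → V) : ℝ) with hK
  have hKpos : 0 < K := Nat.cast_pos.2 Fintype.card_pos
  have hsum := Finset.sum_le_sum fun x (_ : x ∈ (Finset.univ : Finset (Fin (T + 1) → V))) =>
    success_le hG P A enc hA he hN x
  rw [Finset.sum_add_distrib, ← Finset.mul_sum, Finset.sum_comm] at hsum
  have hlast := card_mul_sum_apply_eq (Fin.ofNat (T + 1) T)
    (fun x v => measureProb (A.hybridState (heightOracle P enc e x) T) {v})
    (fun x => by rw [sum_measureProb_singleton, A.norm_hybridState, one_pow])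
    (fun x a => by rw [hybridState_heightOracle_update A P enc e le_rfl le_rfl])
  have hlast' : ∑ x, measureProb (A.hybridState (heightOracle P enc e x) T)
      {x (Fin.ofNat (T + 1) T)} ≤ K / 2 := by
    rw [le_div_iff₀ two_pos, mul_comm, hK, ← hlast]
    exact mul_le_mul_of_nonneg_right hn (Finset.sum_nonneg fun _ _ => measureProb_nonneg _ _)
  -- `r ^ 2` is the bound on the average mass at the disagreement, so `r` bounds the average of its
  -- square root.
  set r : ℝ := √(T * g) / n with hr
  have hr0 : 0 ≤ r := by positivity
  have hr2 : n ^ 2 * r ^ 2 = T * g := by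
    rw [hr, div_pow, Real.sq_sqrt (by positivity)]
    field_simp
  have hstep : ∀ t ∈ Finset.range T, ∑ x : Fin (T + 1) → V, √(measureProb
      (A.hybridState (heightOracle P enc e x) t)
        {v | heightOracle P enc e x T v ≠ heightOracle P enc e x t v}) ≤ K * r := by
    intro t ht
    refine sum_sqrt_le _ (fun x => measureProb_nonneg _ _) ?_ hr0
    refine le_of_mul_le_mul_left ?_ (show 0 < n ^ 2 by positivity)
    refine (sum_measureProb_heightOracle_ne_le A P enc e (Finset.mem_range.1 ht)).trans_eq ?_
    linear_combination (-K) * hr2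
  have hstep' := Finset.sum_le_card_nsmul _ _ _ hstep
  rw [Finset.card_range, nsmul_eq_mul] at hstep'
  rw [Finset.sum_const, Finset.card_univ, nsmul_eq_mul, ← hK] at hsum
  -- On average `2 / 3 ≤ 1 / 2 + 4 * T * r`; squaring 24 gives the constant 576.
  have h24 : 1 ≤ 24 * (T * r) := by
    have : K * 1 ≤ K * (24 * (T * r)) := by nlinarith
    exact le_of_mul_le_mul_left this hKpos
  have hsq : 1 ≤ (24 * (T * r)) ^ 2 := one_le_pow₀ h24
  calc n ^ 2 = n ^ 2 * 1 := (mul_one _).symm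
    _ ≤ n ^ 2 * (24 * (T * r)) ^ 2 := mul_le_mul_of_nonneg_left hsq (by positivity)
    _ = 576 * (T ^ 3 * g) := by linear_combination 576 * (T : ℝ) ^ 2 * hr2

theorem rpow_div_sqrt_le {n g T : ℝ} (hn : 1 ≤ n) (hg : n ≤ g) (hT : 0 ≤ T)
    (h : n ≤ T ∨ n ^ 2 ≤ 576 * (T ^ 3 * g)) :
    1 / 9 * (n ^ (3 / 4 : ℝ) / √g) ≤ T := by
  set s : ℝ := n ^ (1 / 4 : ℝ)
  have hs1 : 1 ≤ s := Real.one_le_rpow hn (by norm_num)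
  have hs4 : s ^ 4 = n := by
    rw [← Real.rpow_natCast, ← Real.rpow_mul (by linarith)]; norm_num
  have hs3 : n ^ (3 / 4 : ℝ) = s ^ 3 := by
    rw [← Real.rpow_natCast, ← Real.rpow_mul (by linarith)]; norm_num
  have hg0 : 0 ≤ g := by linarith
  set q : ℝ := √g
  have hq2 : q ^ 2 = g := Real.sq_sqrt hg0
  -- This is `√n ≤ √g`. It settles the case `n ≤ T` and below supplies the missing factor `√g` after
  -- cubing; `9 ^ 3 ≥ 576` explains the constant `1 / 9`.
  have hqs : s ^ 2 ≤ q := Real.le_sqrt_of_sq_le (by rw [← pow_mul, hs4]; exact hg)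
  have hq : 0 < q := by nlinarith
  rw [hs3]
  rcases h with h | h
  · have h1 : s ^ 3 / q ≤ s := by
      rw [div_le_iff₀ hq]
      nlinarith
    have h2 : s ≤ s ^ 4 := le_self_pow₀ hs1 (by norm_num)
    linarith
  · refine (pow_le_pow_iff_left₀ (by positivity) hT (by norm_num : 3 ≠ 0)).1 ?_
    rw [← hs4, ← hq2] at h
    have h1 : s ^ 9 ≤ 576 * T ^ 3 * q ^ 3 := by
      calc s ^ 9 ≤ s ^ 8 * s ^ 2 := by
            rw [← pow_add]; exact pow_le_pow_right₀ hs1 (by norm_num)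
        _ ≤ 576 * (T ^ 3 * q ^ 2) * q :=
            mul_le_mul (by nlinarith) hqs (by positivity) (by positivity)
        _ = 576 * T ^ 3 * q ^ 3 := by ring
    rw [mul_pow, div_pow (s ^ 3), ← pow_mul, ← mul_div_assoc, div_le_iff₀ (by positivity)]
    have : 0 ≤ T ^ 3 * q ^ 3 := by positivity
    norm_num
    nlinarith

end LowerBound

end LocalSearch

theorem theorem1 :
    ∃ c : ℝ, 0 < c ∧
      ∀ (V : Type) [Fintype V] [DecidableEq V] (G : SimpleGraph V),
        G.Connected → 2 ≤ Fintype.card V →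
        ∀ (B : Type) (S : Set ℝ) (enc : S ↪ (B → Bool)),
          (((Fintype.card V) ^ 2 + 2 * Fintype.card V + 1 : ℕ) : ℕ∞) ≤ S.encard →
          ENNReal.ofReal
              (c * ((Fintype.card V : ℝ) ^ (3 / 4 : ℝ) /
                √(LocalSearch.vertexCongestion G : ℝ))) ≤
            ((LocalSearch.quantumQueryComplexity G enc : ℕ∞) : ℝ≥0∞) := by
  refine ⟨1 / 9, by norm_num, fun V _ _ G hG hV B S enc hS => ?_⟩
  obtain ⟨P, hP⟩ := LocalSearch.exists_vertexCongestion_eq hG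
  have : Nonempty V := hG.nonempty
  rw [← hP]
  set b : ℝ := 1 / 9 * ((Fintype.card V : ℝ) ^ (3 / 4 : ℝ) / √(P.vertexCongestion : ℝ))
  have hT : ∀ T : ℕ, (∃ A : LocalSearch.QueryAlgorithm V B T, A.SolvesLocalSearch G enc) →
      b ≤ T := by
    rintro T ⟨A, hA⟩
    refine LocalSearch.rpow_div_sqrt_le (by exact_mod_cast (by omega : 1 ≤ Fintype.card V))
      (by exact_mod_cast LocalSearch.card_le_vertexCongestion P) (Nat.cast_nonneg T) ?_
    -- For `T < n` all heights are at most `(T + 1) * n ≤ n ^ 2`, so `S` has enough values; for `T ≥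
    -- n` the bound needs no adversary.
    rcases le_or_gt (Fintype.card V) T with h | h
    · exact Or.inl (by exact_mod_cast h)
    · exact Or.inr (LocalSearch.card_sq_le_of_solves hG hV P A enc hA hS (by nlinarith))
  have hceil : ((⌈b⌉₊ : ℕ) : ℕ∞) ≤ LocalSearch.quantumQueryComplexity G enc :=
    le_iInf₂ fun T h => by exact_mod_cast Nat.ceil_le.2 (hT T h)
  calc ENNReal.ofReal b ≤ ENNReal.ofReal (⌈b⌉₊ : ℝ) := ENNReal.ofReal_le_ofReal (Nat.le_ceil b)
    _ = (((⌈b⌉₊ : ℕ) : ℕ∞) : ℝ≥0∞) := by simp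
    _ ≤ _ := by exact_mod_cast hceil
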